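/- Let $d\ge 0$, let $\mathcal E_d$ be the group of all isometries of Euclidean space $\mathbb R^d$, and let $G\le \mathcal E_d$ be a finitely generated subgroup (not assumed to be discrete, or to act properly or cocompactly). If $\gamma\in G$ is any element of infinite order, then the infinite cyclic subgroup $\langle\gamma\rangle$ is undistorted in $G$. Here, for a group $K$ generated by a finite set $S$, $l_S(g)$ denotes the word length of $g\in K$, i.e. the least $n$ such that $g$ is a product of $n$ elements of $S\cup S^{-1}$. A finitely generated subgroup $H$ of a finitely generated group $G$ is undistorted in $G$ if for all finite generating sets $S$ of $G$ and $T$ of $H$ there is a constant $C>0$ such that $l_T(h)\le C\,l_S(h)$ for all $h\in H$. -/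

import Mathlib

/-- The word length of `g` with respect to `S`: the least length of a product of elements of `S`
and inverses of elements of `S` that equals `g`. (It is only used when `S` generates the group, so
that the set of lengths is non-empty.) -/
noncomputable def wordLength {G : Type*} [Group G] (S : Set G) (g : G) : ℕ :=
  sInf {n : ℕ | ∃ l : List G, l.length = n ∧ (∀ x ∈ l, x ∈ S ∨ x⁻¹ ∈ S) ∧ l.prod = g}

/-- A finitely generated subgroup `H` of a finitely generated group `G` is undistorted if, for all
finite generating sets `S` of `G` and `T` of `H`, the word length of `H` with respect to `T` is
bounded on `H` by a constant multiple of the word length of `G` with respect to `S`. -/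
def IsUndistorted {G : Type*} [Group G] (H : Subgroup G) : Prop :=
  Group.FG G ∧ Group.FG H ∧
    ∀ (S : Set G) (T : Set H), S.Finite → Subgroup.closure S = ⊤ →
      T.Finite → Subgroup.closure T = ⊤ →
        ∃ C : ℝ, 0 < C ∧ ∀ h : H, (wordLength T h : ℝ) ≤ C * (wordLength S (h : G) : ℝ)

/-! A subadditive function on a finitely generated group is bounded linearly by word length, so
`⟨γ⟩` is undistorted once such a function grows at least linearly along the powers of `γ`. Two
functions suffice.

If the linear part of `γ` has finite order, some power of `γ` is a nontrivial translation, and the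
displacement of the origin works.

Otherwise the complexified linear part is unitary of infinite order, hence diagonalizable with an
eigenvalue `z` that is not a root of unity. The usual norm of `z` is 1, but
`exists_absoluteValue_ne_one` supplies another absolute value on `ℂ`, pulled back along a wild
embedding into `ℂ` or an algebraic closure of `ℚ_p`, for which it is not. After possibly inverting
`γ`, the logarithm of the size of the matrix entries grows linearly. -/

/-! ### Absolute values on `ℂ` that detect non-roots of unity -/

open Cardinal in
theorem exists_ringHom_comp_eq {R K Ω : Type} [CommRing R] [IsDomain R] [Countable R]
    [Field K] [IsAlgClosed K] [Field Ω] [IsAlgClosed Ω] (f : R →+* K) (g : R →+* Ω)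
    (hf : Function.Injective f) (hg : Function.Injective g) (hΩ : ℵ₀ < #Ω) (hK : #K ≤ #Ω) :
    ∃ σ : K →+* Ω, ∀ r, σ (f r) = g r := by
  let _ := f.toAlgebra
  let _ := g.toAlgebra
  have : FaithfulSMul R K := (faithfulSMul_iff_algebraMap_injective R K).2 hf
  have : FaithfulSMul R Ω := (faithfulSMul_iff_algebraMap_injective R Ω).2 hg
  obtain ⟨s, hs⟩ := exists_isTranscendenceBasis R K
  obtain ⟨t, ht⟩ := exists_isTranscendenceBasis R Ω
  -- As `R` is countable and `Ω` is not, `t` is as large as `Ω`, so `s` injects into `t`. This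
  -- embeds `R[s]` in `Ω`; `K` is algebraic over `R[s]`, so the embedding extends to `K`.
  have h1 : #Ω = #t := IsAlgClosed.cardinal_eq_cardinal_transcendence_basis_of_aleph0_lt'
    _ ht (mk_le_aleph0) hΩ
  have h2 : #s ≤ #t := (mk_set_le s).trans (hK.trans h1.le)
  obtain ⟨e⟩ := h2
  let i1 : Algebra (MvPolynomial s R) K := (MvPolynomial.aeval ((↑) : s → K)).toRingHom.toAlgebra
  let i2 : Algebra (MvPolynomial s R) Ω :=
    (MvPolynomial.aeval (fun i => (e i : Ω))).toRingHom.toAlgebra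
  have : FaithfulSMul (MvPolynomial s R) K :=
    (faithfulSMul_iff_algebraMap_injective _ K).2 hs.1
  have : FaithfulSMul (MvPolynomial s R) Ω :=
    (faithfulSMul_iff_algebraMap_injective _ Ω).2 (ht.1.comp e e.injective)
  have : Algebra.IsAlgebraic (MvPolynomial s R) K := by
    have := hs.isAlgebraic
    refine ⟨fun x => ?_⟩
    have hx := this.1 x
    exact hx.of_ringHom_of_comp_eq
        hs.1.aevalEquiv.toRingEquiv.toRingHom (RingHom.id K) hs.1.aevalEquiv.surjective
        Function.injective_id (by ext <;> simp [RingHom.algebraMap_toAlgebra])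
  let σ : K →ₐ[MvPolynomial s R] Ω := IsAlgClosed.lift
  refine ⟨σ.toRingHom, fun r => ?_⟩
  have h := σ.commutes (MvPolynomial.C r)
  simpa [RingHom.algebraMap_toAlgebra] using h

-- If `‖z‖ = 1`, some endomorphism of `ℂ` sends `z` to the equally transcendental `2 * z`, of norm
-- 2.
open Cardinal in
theorem exists_absoluteValue_ne_one_of_transcendental {z : ℂ} (hz : Transcendental ℤ z) :
    ∃ v : AbsoluteValue ℂ ℝ, v z ≠ 1 := by
  by_cases h : ‖z‖ = 1
  swap
  · exact ⟨NormedField.toAbsoluteValue ℂ, h⟩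
  have hz2 : Transcendental ℤ (2 * z) := by
    intro h2
    apply hz
    have : IsAlgebraic ℚ ((2 : ℂ)⁻¹ * (2 * z)) := by
      refine IsAlgebraic.mul ?_ ?_
      · simpa using isAlgebraic_algebraMap (A := ℂ) ((2 : ℚ)⁻¹)
      · exact (IsFractionRing.isAlgebraic_iff ℤ ℚ ℂ).1 h2
    rw [← mul_assoc, inv_mul_cancel₀ two_ne_zero, one_mul] at this
    exact (IsFractionRing.isAlgebraic_iff ℤ ℚ ℂ).2 this
  have : Countable (Polynomial ℤ) := by
    rw [← Cardinal.mk_le_aleph0_iff]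
    simp
  obtain ⟨σ, hσ⟩ := exists_ringHom_comp_eq (Polynomial.aeval (R := ℤ) z).toRingHom
    (Polynomial.aeval (R := ℤ) (2 * z)).toRingHom
    (transcendental_iff_injective.1 hz) (transcendental_iff_injective.1 hz2)
    (by rw [Cardinal.mk_complex]; exact aleph0_lt_continuum) le_rfl
  refine ⟨(NormedField.toAbsoluteValue ℂ).comp σ.injective, ?_⟩
  have := hσ Polynomial.X
  simp only [AlgHom.toRingHom_eq_coe, RingHom.coe_coe, Polynomial.aeval_X] at this
  change ‖σ z‖ ≠ 1
  rw [this, norm_mul, h]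
  norm_num

-- By Kronecker's theorem some conjugate of `z` lies off the unit circle; the embedding reaching it
-- extends to all of `ℂ`.
open Cardinal IntermediateField in
theorem exists_absoluteValue_ne_one_of_isIntegral {z : ℂ} (hz : IsIntegral ℤ z)
    (h : ∀ n : ℕ, 0 < n → z ^ n ≠ 1) : ∃ v : AbsoluteValue ℂ ℝ, v z ≠ 1 := by
  have hq : IsIntegral ℚ z := hz.tower_top
  have : FiniteDimensional ℚ ℚ⟮z⟯ := adjoin.finiteDimensional hq
  have : NumberField ℚ⟮z⟯ := ⟨⟩
  have hg : IsIntegral ℤ (AdjoinSimple.gen ℚ z) := by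
    rw [← isIntegral_algebraMap_iff (B := ℂ) (algebraMap ℚ⟮z⟯ ℂ).injective]
    simpa using hz
  have : ∃ φ : ℚ⟮z⟯ →+* ℂ, ‖φ (AdjoinSimple.gen ℚ z)‖ ≠ 1 := by
    by_contra! hc
    obtain ⟨n, hn, he⟩ := NumberField.Embeddings.pow_eq_one_of_norm_eq_one _ ℂ hg hc
    refine h n hn ?_
    simpa using congrArg (algebraMap ℚ⟮z⟯ ℂ) he
  obtain ⟨φ, hφ⟩ := this
  have : Countable ℚ⟮z⟯ := by
    rw [← Cardinal.mk_le_aleph0_iff]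
    simpa using Algebra.IsAlgebraic.cardinalMk_le_max ℚ ℚ⟮z⟯
  obtain ⟨σ, hσ⟩ := exists_ringHom_comp_eq (algebraMap ℚ⟮z⟯ ℂ) φ
    (algebraMap ℚ⟮z⟯ ℂ).injective φ.injective
    (by rw [Cardinal.mk_complex]; exact aleph0_lt_continuum) le_rfl
  refine ⟨(NormedField.toAbsoluteValue ℂ).comp σ.injective, ?_⟩
  have := hσ (AdjoinSimple.gen ℚ z)
  rw [AdjoinSimple.algebraMap_gen] at this
  change ‖σ z‖ ≠ 1
  rwa [this]

/-- A rational number that is not an integer has `p`-adic norm greater than one for some `p`. -/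
theorem exists_prime_one_lt_norm_padic {q : ℚ} (hq : q ∉ (algebraMap ℤ ℚ).range) :
    ∃ (p : ℕ) (_ : Fact p.Prime), 1 < ‖(q : ℚ_[p])‖ := by
  have hd : q.den ≠ 1 := fun h => hq ⟨q.num, by
    simpa using (Rat.den_eq_one_iff q).1 h⟩
  obtain ⟨p, hp, hpd⟩ := Nat.exists_prime_and_dvd hd
  have := Fact.mk hp
  refine ⟨p, ‹_›, ?_⟩
  by_contra! h
  exact PadicInt.p_nonunit (isUnit_of_dvd_unit (Nat.cast_dvd_cast hpd) (PadicInt.isUnit_den q h))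

open Polynomial in
/-- The coefficients of a product of linear factors with roots in the closed unit ball of an
ultrametric field lie in the closed unit ball. -/
theorem norm_coeff_prod_X_sub_C_le_one {Ω : Type*} [NormedField Ω] [IsUltrametricDist Ω]
    (s : Multiset Ω) (hs : ∀ x ∈ s, ‖x‖ ≤ 1) (i : ℕ) :
    ‖((s.map fun a => X - C a).prod).coeff i‖ ≤ 1 := by
  induction s using Multiset.induction generalizing i with
  | empty =>
    simp only [Multiset.map_zero, Multiset.prod_zero, coeff_one]
    split_ifs <;> simp
  | cons a s ih =>
    have ih' := fun i => ih (i := i) fun x hx => hs x (Multiset.mem_cons_of_mem hx)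
    rw [Multiset.map_cons, Multiset.prod_cons, sub_mul, coeff_sub, coeff_C_mul]
    rw [sub_eq_add_neg]
    refine (IsUltrametricDist.norm_add_le_max _ _).trans (max_le ?_ ?_)
    · cases i with
      | zero => simp
      | succ i => simpa only [coeff_X_mul] using ih' i
    · rw [norm_neg, norm_mul]
      exact mul_le_one₀ (hs a (Multiset.mem_cons_self a s)) (norm_nonneg _) (ih' i)

-- A non-integral coefficient of the minimal polynomial has norm above 1 at some `p`, so some
-- `p`-adic root does too, and `ℂ` embeds in `PadicAlgCl p` sending `z` to that root.
open Cardinal IntermediateField Polynomial in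
theorem exists_absoluteValue_ne_one_of_not_isIntegral {z : ℂ} (hq : IsIntegral ℚ z)
    (hz : ¬ IsIntegral ℤ z) : ∃ v : AbsoluteValue ℂ ℝ, v z ≠ 1 := by
  have hc : ∃ i, (minpoly ℚ z).coeff i ∉ (algebraMap ℤ ℚ).range := by
    by_contra! hc
    obtain ⟨P, hP, -, hm⟩ := lifts_and_natDegree_eq_and_monic
      ((lifts_iff_coeff_lifts _).2 hc) (minpoly.monic hq)
    refine hz ⟨P, hm, ?_⟩
    have := minpoly.aeval ℚ z
    rwa [← hP, aeval_map_algebraMap] at this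
  obtain ⟨i, hi⟩ := hc
  obtain ⟨p, hp, hpi⟩ := exists_prime_one_lt_norm_padic hi
  set Q := (minpoly ℚ z).map (algebraMap ℚ (PadicAlgCl p)) with hQ
  have hQs : (Q.roots.map fun a => X - C a).prod = Q :=
    ((IsAlgClosed.splits Q).eq_prod_roots_of_monic ((minpoly.monic hq).map _)).symm
  have hμ : ∃ μ ∈ Q.roots, 1 < ‖μ‖ := by
    by_contra! hμ
    have h1 := norm_coeff_prod_X_sub_C_le_one Q.roots hμ i
    rw [hQs, hQ, coeff_map, eq_ratCast, ← map_ratCast (algebraMap ℚ_[p] (PadicAlgCl p)),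
      norm_algebraMap'] at h1
    exact h1.not_gt hpi
  obtain ⟨μ, hμQ, hμ⟩ := hμ
  let φ : ℚ⟮z⟯ →ₐ[ℚ] PadicAlgCl p :=
    (algHomAdjoinIntegralEquiv ℚ hq).symm ⟨μ, hμQ⟩
  have hφ : φ (AdjoinSimple.gen ℚ z) = μ := algHomAdjoinIntegralEquiv_symm_apply_gen ℚ hq ⟨μ, hμQ⟩
  have : FiniteDimensional ℚ ℚ⟮z⟯ := adjoin.finiteDimensional hq
  have : Countable ℚ⟮z⟯ := by
    rw [← Cardinal.mk_le_aleph0_iff]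
    simpa using Algebra.IsAlgebraic.cardinalMk_le_max ℚ ℚ⟮z⟯
  have hcard : 𝔠 ≤ #(PadicAlgCl p) := continuum_le_cardinal_of_module ℚ_[p] _
  obtain ⟨σ, hσ⟩ := exists_ringHom_comp_eq (algebraMap ℚ⟮z⟯ ℂ) φ.toRingHom
    (algebraMap ℚ⟮z⟯ ℂ).injective φ.injective (aleph0_lt_continuum.trans_le hcard)
    (by rwa [Cardinal.mk_complex])
  refine ⟨(NormedField.toAbsoluteValue (PadicAlgCl p)).comp σ.injective, ?_⟩
  have := (hσ (AdjoinSimple.gen ℚ z)).trans hφ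
  rw [AdjoinSimple.algebraMap_gen] at this
  change ‖σ z‖ ≠ 1
  rw [this]
  exact hμ.ne'

theorem exists_absoluteValue_ne_one {z : ℂ} (h : ∀ n : ℕ, 0 < n → z ^ n ≠ 1) :
    ∃ v : AbsoluteValue ℂ ℝ, v z ≠ 1 := by
  by_cases h1 : IsAlgebraic ℤ z
  · by_cases h2 : IsIntegral ℤ z
    · exact exists_absoluteValue_ne_one_of_isIntegral h2 h
    · exact exists_absoluteValue_ne_one_of_not_isIntegral ((IsFractionRing.isAlgebraic_iff ℤ ℚ ℂ).1 h1).isIntegral h2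
  · exact exists_absoluteValue_ne_one_of_transcendental h1

/-! ### Word length and subadditive functions -/

section WordLength

variable {G : Type*} [Group G] {S : Set G}

theorem wordLength_prod_le {l : List G} (hl : ∀ x ∈ l, x ∈ S ∨ x⁻¹ ∈ S) :
    wordLength S l.prod ≤ l.length :=
  Nat.sInf_le ⟨l, rfl, hl, rfl⟩

theorem exists_list_length_eq_wordLength (hS : Subgroup.closure S = ⊤) (g : G) :
    ∃ l : List G, l.length = wordLength S g ∧ (∀ x ∈ l, x ∈ S ∨ x⁻¹ ∈ S) ∧ l.prod = g := by
  have hg : g ∈ Submonoid.closure (S ∪ S⁻¹) := by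
    rw [← Subgroup.closure_toSubmonoid, hS]
    exact Subgroup.mem_top g
  obtain ⟨l, hl, hp⟩ := Submonoid.exists_list_of_mem_closure hg
  exact Nat.sInf_mem (s := {n : ℕ | ∃ l : List G, l.length = n ∧ (∀ x ∈ l, x ∈ S ∨ x⁻¹ ∈ S) ∧
    l.prod = g}) ⟨_, l, rfl, hl, hp⟩

theorem wordLength_one : wordLength S (1 : G) = 0 :=
  Nat.le_zero.1 (wordLength_prod_le (l := []) (by simp))

theorem wordLength_mul_le (hS : Subgroup.closure S = ⊤) (g h : G) :
    wordLength S (g * h) ≤ wordLength S g + wordLength S h := by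
  obtain ⟨l, hl, hlS, rfl⟩ := exists_list_length_eq_wordLength hS g
  obtain ⟨k, hk, hkS, rfl⟩ := exists_list_length_eq_wordLength hS h
  rw [← hl, ← hk, ← List.length_append, ← List.prod_append]
  exact wordLength_prod_le fun x hx => (List.mem_append.1 hx).elim (hlS x) (hkS x)

theorem wordLength_pow_le (hS : Subgroup.closure S = ⊤) (g : G) (n : ℕ) :
    wordLength S (g ^ n) ≤ n * wordLength S g := by
  induction n with
  | zero => simp [wordLength_one]
  | succ n ih =>
    rw [pow_succ, Nat.succ_mul]
    exact (wordLength_mul_le hS _ _).trans (Nat.add_le_add_right ih _)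

theorem wordLength_inv_le (hS : Subgroup.closure S = ⊤) (g : G) :
    wordLength S g⁻¹ ≤ wordLength S g := by
  obtain ⟨l, hl, hlS, rfl⟩ := exists_list_length_eq_wordLength hS g
  rw [← hl, List.prod_inv_reverse]
  refine (wordLength_prod_le ?_).trans_eq (by simp)
  intro x hx
  simp only [List.mem_reverse, List.mem_map] at hx
  obtain ⟨y, hy, rfl⟩ := hx
  rw [inv_inv]
  exact (hlS y hy).symm

theorem wordLength_inv (hS : Subgroup.closure S = ⊤) (g : G) :
    wordLength S g⁻¹ = wordLength S g :=
  (wordLength_inv_le hS g).antisymm (by simpa using wordLength_inv_le hS g⁻¹)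

theorem one_le_wordLength (hS : Subgroup.closure S = ⊤) {g : G} (hg : g ≠ 1) :
    1 ≤ wordLength S g := by
  obtain ⟨l, hl, -, rfl⟩ := exists_list_length_eq_wordLength hS g
  rw [← hl, Nat.one_le_iff_ne_zero]
  intro h
  exact hg (by rw [List.eq_nil_of_length_eq_zero h, List.prod_nil])

/-- A subadditive function on a finitely generated group grows at most linearly in the word
length. -/
theorem exists_le_mul_wordLength (hfin : S.Finite) (hS : Subgroup.closure S = ⊤) {f : G → ℝ}
    (hf : ∀ g h, f (g * h) ≤ f g + f h) :
    ∃ D : ℝ, 0 < D ∧ ∀ g ≠ 1, f g ≤ D * wordLength S g := by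
  obtain ⟨B, hB⟩ := ((hfin.union hfin.inv).image f).bddAbove
  have hB' : ∀ x, (x ∈ S ∨ x⁻¹ ∈ S) → f x ≤ B := fun x hx =>
    hB ⟨x, by simpa using hx, rfl⟩
  have key : ∀ l : List G, (∀ x ∈ l, x ∈ S ∨ x⁻¹ ∈ S) → f l.prod ≤ B * l.length + f 1 := by
    intro l hl
    induction l with
    | nil => simp
    | cons a l ih =>
      have h1 := ih fun x hx => hl x (List.mem_cons_of_mem a hx)
      have h2 := hB' a (hl a List.mem_cons_self)
      have h3 := hf a l.prod
      rw [List.prod_cons, List.length_cons]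
      push_cast
      linarith
  -- The additive term `f 1` is absorbed because a nontrivial element has length at least 1.
  refine ⟨|B| + |f 1| + 1, by positivity, fun g hg => ?_⟩
  have h1 := one_le_wordLength hS hg
  obtain ⟨l, hl, hlS, hp⟩ := exists_list_length_eq_wordLength hS g
  have h2 := key l hlS
  rw [hp, hl] at h2
  have h1' : (1 : ℝ) ≤ wordLength S g := mod_cast h1
  nlinarith [le_abs_self B, le_abs_self (f 1), abs_nonneg (f 1)]

end WordLength

/-- A cyclic subgroup along which some subadditive function grows linearly is undistorted. -/
theorem isUndistorted_zpowers_of_subadditive {G : Type*} [Group G] (hG : Group.FG G) (γ : G)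
    {f : G → ℝ} (hf : ∀ g h, f (g * h) ≤ f g + f h) {b c : ℝ} (hc : 0 < c)
    (hγ : ∀ n : ℕ, c * n ≤ f (γ ^ n) + b) : IsUndistorted (Subgroup.zpowers γ) := by
  refine ⟨hG, ?_, fun S T hS hS' hT hT' => ?_⟩
  · rw [Group.fg_iff_subgroup_fg, Subgroup.zpowers_eq_closure]
    exact ⟨{γ}, by simp⟩
  obtain ⟨D, hD, hDf⟩ := exists_le_mul_wordLength hS hS' hf
  set γ' : Subgroup.zpowers γ := ⟨γ, Subgroup.mem_zpowers γ⟩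
  -- The `+ 1` keeps the constant positive even if `γ'` has length 0.
  have hpow : ∀ n : ℕ, (wordLength T (γ' ^ n) : ℝ) ≤
      (D + |b|) / c * (wordLength T γ' + 1) * wordLength S (γ ^ n) := by
    intro n
    by_cases h1 : γ ^ n = 1
    · have : γ' ^ n = 1 := Subtype.ext h1
      rw [this, h1, wordLength_one, wordLength_one]
      simp
    · have h2 : (1 : ℝ) ≤ wordLength S (γ ^ n) := mod_cast one_le_wordLength hS' h1
      have h3 : c * n ≤ (D + |b|) * wordLength S (γ ^ n) := by
        nlinarith [hγ n, hDf _ h1, le_abs_self b, abs_nonneg b]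
      have h4 : (n : ℝ) ≤ (D + |b|) * wordLength S (γ ^ n) / c := by
        rw [le_div_iff₀ hc]; linarith
      have h5 : (wordLength T (γ' ^ n) : ℝ) ≤ n * wordLength T γ' :=
        mod_cast wordLength_pow_le hT' γ' n
      calc (wordLength T (γ' ^ n) : ℝ) ≤ n * (wordLength T γ' + 1) := by
            have : (0 : ℝ) ≤ n := n.cast_nonneg
            linarith
        _ ≤ (D + |b|) * wordLength S (γ ^ n) / c * (wordLength T γ' + 1) := by gcongr
        _ = _ := by ring
  refine ⟨(D + |b|) / c * (wordLength T γ' + 1), by positivity, fun h => ?_⟩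
  obtain ⟨k, hk⟩ := Subgroup.mem_zpowers_iff.1 h.2
  have hk' : h = γ' ^ k := Subtype.ext hk.symm
  obtain ⟨n, rfl | rfl⟩ := k.eq_nat_or_neg
  · rw [hk']
    simpa using hpow n
  · rw [hk', zpow_neg, wordLength_inv hT', Subgroup.coe_inv, wordLength_inv hS']
    simpa using hpow n

/-- A cyclic subgroup along which some submultiplicative function grows exponentially is
undistorted. -/
theorem isUndistorted_zpowers_of_submultiplicative {G : Type*} [Group G] (hG : Group.FG G) (γ : G)
    {N : G → ℝ} (hpos : ∀ g, 0 < N g) (hN : ∀ g h, N (g * h) ≤ N g * N h) {a r : ℝ} (ha : 0 < a)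
    (hr : 1 < r) (hγ : ∀ n : ℕ, a * r ^ n ≤ N (γ ^ n)) : IsUndistorted (Subgroup.zpowers γ) := by
  refine isUndistorted_zpowers_of_subadditive hG γ (f := fun g => Real.log (N g))
    (b := -Real.log a) (fun g h => ?_) (Real.log_pos hr) fun n => ?_
  · rw [← Real.log_mul (hpos g).ne' (hpos h).ne']
    exact Real.log_le_log (hpos _) (hN g h)
  · have h0 : 0 < r ^ n := pow_pos (zero_lt_one.trans hr) n
    have h1 := Real.log_le_log (mul_pos ha h0) (hγ n)
    rw [Real.log_mul ha.ne' h0.ne', Real.log_pow] at h1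
    linarith

/-! ### Matrix size and eigenvalues -/

section EntrySum

variable {n K : Type*} [Fintype n] [Field K] (v : AbsoluteValue K ℝ)

/-- The sum of the absolute values of the entries of a matrix. -/
def entrySum (M : Matrix n n K) : ℝ := ∑ i, ∑ j, v (M i j)

theorem entrySum_nonneg (M : Matrix n n K) : 0 ≤ entrySum v M :=
  Finset.sum_nonneg fun _ _ => Finset.sum_nonneg fun _ _ => v.nonneg _

theorem le_entrySum (M : Matrix n n K) (i j : n) : v (M i j) ≤ entrySum v M :=
  (Finset.single_le_sum (f := fun j => v (M i j)) (fun _ _ => v.nonneg _) (Finset.mem_univ j)).trans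
    (Finset.single_le_sum (f := fun i => ∑ j, v (M i j))
      (fun _ _ => Finset.sum_nonneg fun _ _ => v.nonneg _) (Finset.mem_univ i))

theorem entrySum_mul_le (A B : Matrix n n K) :
    entrySum v (A * B) ≤ entrySum v A * entrySum v B := by
  have h : ∀ i j, v ((A * B) i j) ≤ (∑ k, v (A i k)) * ∑ k, v (B k j) := fun i j => by
    rw [Matrix.mul_apply]
    refine (v.sum_le _ _).trans ?_
    simp only [map_mul]
    rw [Finset.sum_mul]
    refine Finset.sum_le_sum fun k _ => ?_
    exact mul_le_mul_of_nonneg_left (Finset.single_le_sum (f := fun k => v (B k j))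
      (fun _ _ => v.nonneg _) (Finset.mem_univ k)) (v.nonneg _)
  calc entrySum v (A * B) ≤ ∑ i, ∑ j, (∑ k, v (A i k)) * ∑ k, v (B k j) :=
        Finset.sum_le_sum fun i _ => Finset.sum_le_sum fun j _ => h i j
    _ = entrySum v A * entrySum v B := by
        rw [entrySum, entrySum, Finset.sum_comm (f := fun i j => v (B i j)), Finset.sum_mul_sum]

open Matrix in
/-- An element of a finitely generated linear group having an eigenvalue of absolute value
greater than one generates an undistorted subgroup. -/
theorem isUndistorted_zpowers_of_eigenvector [DecidableEq n] {G : Type*} [Group G]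
    (hG : Group.FG G) (ρ : G →* Matrix n n K) (γ : G) {x : n → K} (hx : x ≠ 0) {z : K}
    (hz : 1 < v z) (hγ : ρ γ *ᵥ x = z • x) : IsUndistorted (Subgroup.zpowers γ) := by
  obtain ⟨i, hi⟩ := Function.ne_iff.1 hx
  have hX : 0 < ∑ j, v (x j) := (v.pos hi).trans_le
    (Finset.single_le_sum (f := fun j => v (x j)) (fun _ _ => v.nonneg _) (Finset.mem_univ i))
  have hpow : ∀ m : ℕ, ρ (γ ^ m) *ᵥ x = z ^ m • x := by
    intro m
    induction m with
    | zero => simp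
    | succ m ih =>
      rw [pow_succ, map_mul, ← mulVec_mulVec, hγ, mulVec_smul, ih, smul_smul, pow_succ']
  refine isUndistorted_zpowers_of_submultiplicative hG γ (N := fun g => entrySum v (ρ g))
    (a := v (x i) / ∑ j, v (x j)) (fun g => ?_) (fun g h => ?_) (div_pos (v.pos hi) hX) hz
    fun m => ?_
  · refine (entrySum_nonneg v _).lt_of_ne' fun h0 => ?_
    have h1 := entrySum_mul_le v (ρ g) (ρ g⁻¹)
    rw [h0, zero_mul, ← map_mul, mul_inv_cancel, map_one] at h1
    have h2 := (le_entrySum v (1 : Matrix n n K) i i).trans h1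
    rw [one_apply_eq, map_one] at h2
    exact h2.not_gt one_pos
  · rw [map_mul]
    exact entrySum_mul_le v _ _
  -- Coordinate `i` of `ρ (γ ^ m) *ᵥ x = z ^ m • x`, where `x i ≠ 0`, bounds the entry sum from
  -- below; hence the choice of `a`.
  · have h1 := congrFun (hpow m) i
    rw [div_mul_eq_mul_div, div_le_iff₀ hX, mul_comm, ← map_pow, ← map_mul]
    change v (z ^ m * x i) ≤ _
    rw [← smul_eq_mul, ← Pi.smul_apply, ← h1, mulVec, dotProduct, Finset.mul_sum]
    refine (v.sum_le _ _).trans (Finset.sum_le_sum fun j _ => ?_)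
    rw [map_mul]
    exact mul_le_mul_of_nonneg_right (le_entrySum v _ i j) (v.nonneg _)

end EntrySum

open scoped Matrix.Norms.L2Operator in
/-- A unitary matrix of infinite order has an eigenvalue that is not a root of unity. -/
theorem exists_mem_spectrum_pow_ne_one {n : Type*} [Fintype n] [DecidableEq n]
    {U : Matrix n n ℂ} (hU : U ∈ unitary (Matrix n n ℂ)) (h : ∀ m : ℕ, 0 < m → U ^ m ≠ 1) :
    ∃ z ∈ spectrum ℂ U, ∀ m : ℕ, 0 < m → z ^ m ≠ 1 := by
  by_contra! hc
  choose! k hk hk1 using hc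
  have hfin : (spectrum ℂ U).Finite := Matrix.finite_spectrum U
  have hm : 0 < ∏ z ∈ hfin.toFinset, k z :=
    Finset.prod_pos fun z hz => hk z (hfin.mem_toFinset.1 hz)
  -- The power map with this exponent is 1 on the whole spectrum, so the functional calculus of the
  -- normal matrix `U` forces that power of `U` to be 1.
  refine h _ hm ?_
  have : IsStarNormal U := isStarNormal_of_mem_unitary hU
  rw [← cfc_pow_id (R := ℂ) U, ← cfc_one ℂ U]
  refine cfc_congr fun z hz => ?_
  obtain ⟨l, hl⟩ := Finset.dvd_prod_of_mem k (hfin.mem_toFinset.2 hz)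
  simp only [Pi.one_apply]
  rw [hl, pow_mul, hk1 z hz, one_pow]

open Matrix in
theorem exists_mulVec_eq_smul_of_mem_spectrum {n K : Type*} [Fintype n] [DecidableEq n] [Field K]
    {A : Matrix n n K} {z : K} (hz : z ∈ spectrum K A) : ∃ x ≠ 0, A *ᵥ x = z • x := by
  rw [← Matrix.spectrum_toLin', ← Module.End.hasEigenvalue_iff_mem_spectrum] at hz
  obtain ⟨x, hx⟩ := hz.exists_hasEigenvector
  exact ⟨x, hx.2, by simpa using hx.apply_eq_smul⟩

/-! ### Isometries and their linear parts -/

section IsometryGroup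

variable (d : ℕ)

/-- The linear part of an isometry of Euclidean space. -/
noncomputable def linearPart :
    (EuclideanSpace ℝ (Fin d) ≃ᵢ EuclideanSpace ℝ (Fin d)) →*
      (EuclideanSpace ℝ (Fin d) ≃ₗᵢ[ℝ] EuclideanSpace ℝ (Fin d)) :=
  MonoidHom.mk' IsometryEquiv.toRealLinearIsometryEquiv fun g h => by
    ext1 x
    change (g * h).toRealLinearIsometryEquiv x =
      g.toRealLinearIsometryEquiv (h.toRealLinearIsometryEquiv x)
    rw [h.toRealLinearIsometryEquiv_apply, map_sub]
    simp [IsometryEquiv.mul_apply]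

variable {d}

theorem linearPart_apply (g : EuclideanSpace ℝ (Fin d) ≃ᵢ EuclideanSpace ℝ (Fin d))
    (x : EuclideanSpace ℝ (Fin d)) : linearPart d g x = g x - g 0 :=
  g.toRealLinearIsometryEquiv_apply x

/-- The complexified matrix of a linear map of Euclidean space in the standard basis. -/
noncomputable def complexMatrix :
    (EuclideanSpace ℝ (Fin d) →ₗ[ℝ] EuclideanSpace ℝ (Fin d)) →+* Matrix (Fin d) (Fin d) ℂ :=
  (algebraMap ℝ ℂ).mapMatrix.comp
    (LinearMap.toMatrixOrthonormal (EuclideanSpace.basisFun (Fin d) ℝ) :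
      (EuclideanSpace ℝ (Fin d) →ₗ[ℝ] EuclideanSpace ℝ (Fin d)) →+* Matrix (Fin d) (Fin d) ℝ)

theorem complexMatrix_injective : Function.Injective (complexMatrix (d := d)) :=
  (Matrix.map_injective (algebraMap ℝ ℂ).injective).comp
    (LinearMap.toMatrixOrthonormal (EuclideanSpace.basisFun (Fin d) ℝ)).injective

theorem star_complexMatrix (f : EuclideanSpace ℝ (Fin d) →ₗ[ℝ] EuclideanSpace ℝ (Fin d)) :
    star (complexMatrix f) = complexMatrix (star f) := by
  have : complexMatrix (star f) = (star (LinearMap.toMatrixOrthonormal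
      (EuclideanSpace.basisFun (Fin d) ℝ) f)).map (algebraMap ℝ ℂ) := by
    rw [← map_star]; rfl
  rw [this]
  ext i j
  change star (algebraMap ℝ ℂ _) = algebraMap ℝ ℂ (star _)
  simp

variable (d) in
/-- The endomorphism underlying a linear isometry of Euclidean space. -/
def isometryToEnd : (EuclideanSpace ℝ (Fin d) ≃ₗᵢ[ℝ] EuclideanSpace ℝ (Fin d)) →*
    (EuclideanSpace ℝ (Fin d) →ₗ[ℝ] EuclideanSpace ℝ (Fin d)) where
  toFun f := f.toLinearEquiv.toLinearMap
  map_one' := rfl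
  map_mul' _ _ := rfl

theorem isometryToEnd_apply (f : EuclideanSpace ℝ (Fin d) ≃ₗᵢ[ℝ] EuclideanSpace ℝ (Fin d))
    (x : EuclideanSpace ℝ (Fin d)) : isometryToEnd d f x = f x := rfl

theorem star_isometryToEnd_mul_self
    (f : EuclideanSpace ℝ (Fin d) ≃ₗᵢ[ℝ] EuclideanSpace ℝ (Fin d)) :
    star (isometryToEnd d f) * isometryToEnd d f = 1 := by
  refine LinearMap.ext fun x => ext_inner_right ℝ fun y => ?_
  rw [LinearMap.star_eq_adjoint, Module.End.mul_apply, LinearMap.adjoint_inner_left,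
    isometryToEnd_apply, isometryToEnd_apply, f.inner_map_map, Module.End.one_apply]

variable (d) in
/-- The complexified matrix of a linear isometry of Euclidean space. -/
noncomputable def isometryMatrix :
    (EuclideanSpace ℝ (Fin d) ≃ₗᵢ[ℝ] EuclideanSpace ℝ (Fin d)) →* Matrix (Fin d) (Fin d) ℂ :=
  (complexMatrix (d := d)).toMonoidHom.comp (isometryToEnd d)

theorem isometryMatrix_apply (f : EuclideanSpace ℝ (Fin d) ≃ₗᵢ[ℝ] EuclideanSpace ℝ (Fin d)) :
    isometryMatrix d f = complexMatrix (isometryToEnd d f) := rfl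

theorem isometryMatrix_injective : Function.Injective (isometryMatrix d) := fun f g h => by
  have h1 : isometryToEnd d f = isometryToEnd d g := complexMatrix_injective h
  ext1 x
  rw [← isometryToEnd_apply, h1, isometryToEnd_apply]

theorem isometryMatrix_mem_unitary
    (f : EuclideanSpace ℝ (Fin d) ≃ₗᵢ[ℝ] EuclideanSpace ℝ (Fin d)) :
    isometryMatrix d f ∈ unitary (Matrix (Fin d) (Fin d) ℂ) := by
  have h1 : star (isometryMatrix d f) * isometryMatrix d f = 1 := by
    rw [isometryMatrix_apply, star_complexMatrix, ← map_mul, star_isometryToEnd_mul_self, map_one]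
  exact Unitary.mem_iff.2 ⟨h1, mul_eq_one_comm.1 h1⟩

/-- An element of infinite order whose linear part has finite order generates an undistorted
subgroup. -/
theorem isUndistorted_zpowers_of_linearPart_pow_eq_one
    {G : Subgroup (EuclideanSpace ℝ (Fin d) ≃ᵢ EuclideanSpace ℝ (Fin d))}
    (hG : Group.FG G) {γ : G} (hγ : ¬ IsOfFinOrder γ) {m : ℕ} (hm : 0 < m)
    (h : linearPart d (γ : EuclideanSpace ℝ (Fin d) ≃ᵢ EuclideanSpace ℝ (Fin d)) ^ m = 1) :
    IsUndistorted (Subgroup.zpowers γ) := by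
  set t : EuclideanSpace ℝ (Fin d) := (γ ^ m : G).1 0
  have htrans : ∀ x, (γ ^ m : G).1 x = x + t := fun x => by
    have h1 := linearPart_apply (γ ^ m : G).1 x
    rw [Subgroup.coe_pow, map_pow, h, ← Subgroup.coe_pow] at h1
    exact eq_add_of_sub_eq h1.symm
  have ht0 : t ≠ 0 := fun h0 => hγ <| isOfFinOrder_iff_pow_eq_one.2 ⟨m, hm, by
    ext1
    ext1 x
    rw [htrans, h0, add_zero]
    rfl⟩
  have hf : ∀ g k : G, ‖(g * k).1 0‖ ≤ ‖g.1 0‖ + ‖k.1 0‖ := fun g k => by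
    have h1 : dist (g.1 (k.1 0)) (g.1 0) = dist (k.1 0) 0 := g.1.dist_eq _ _
    have h2 := dist_triangle (g.1 (k.1 0)) (g.1 0) 0
    rw [h1, dist_zero_right, dist_zero_right, dist_zero_right, add_comm] at h2
    exact h2
  have hpow : ∀ k : ℕ, ((γ ^ m) ^ k : G).1 0 = (k : ℝ) • t := fun k => by
    induction k with
    | zero => simp
    | succ k ih =>
      rw [pow_succ']
      change (γ ^ m : G).1 (((γ ^ m) ^ k : G).1 0) = _
      rw [htrans, ih, Nat.cast_succ, add_smul, one_smul]
  have hfm : ∀ (g : G) (k : ℕ), ‖(g ^ k).1 0‖ ≤ k * ‖g.1 0‖ := fun g k => by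
    induction k with
    | zero => simp
    | succ k ih =>
      rw [pow_succ, Nat.cast_succ, add_mul, one_mul]
      exact (hf _ _).trans (by gcongr)
  have hm' : (0 : ℝ) < m := mod_cast hm
  refine isUndistorted_zpowers_of_subadditive hG γ (f := fun g => ‖g.1 0‖) (b := 0) hf
    (div_pos (norm_pos_iff.2 ht0) hm') fun n => ?_
  -- `(γ ^ n) ^ m` is translation by `n • t`, so `n * ‖t‖` is at most `m` times the displacement of
  -- `γ ^ n`; this gives the slope `‖t‖ / m`.
  have h1 := hfm (γ ^ n) m
  rw [← pow_mul, mul_comm, pow_mul, hpow, norm_smul, Real.norm_natCast] at h1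
  rw [add_zero, div_mul_eq_mul_div, div_le_iff₀ hm']
  linarith

end IsometryGroup

open scoped Matrix in
theorem mainTheorem10 (d : ℕ)
    (G : Subgroup (EuclideanSpace ℝ (Fin d) ≃ᵢ EuclideanSpace ℝ (Fin d)))
    (hG : Group.FG G) (γ : G) (hγ : ¬ IsOfFinOrder γ) :
    IsUndistorted (Subgroup.zpowers γ) := by
  by_cases hm : ∃ m : ℕ, 0 < m ∧
      linearPart d (γ : EuclideanSpace ℝ (Fin d) ≃ᵢ EuclideanSpace ℝ (Fin d)) ^ m = 1
  · obtain ⟨m, hm, h⟩ := hm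
    exact isUndistorted_zpowers_of_linearPart_pow_eq_one hG hγ hm h
  push Not at hm
  let ρ : G →* Matrix (Fin d) (Fin d) ℂ :=
    (isometryMatrix d).comp ((linearPart d).comp G.subtype)
  obtain ⟨z, hz, hz1⟩ := exists_mem_spectrum_pow_ne_one (U := ρ γ)
    (isometryMatrix_mem_unitary _) fun m hm0 h => hm m hm0 <| isometryMatrix_injective <| by
      rw [map_pow, map_one]
      exact h
  obtain ⟨x, hx, hxz⟩ := exists_mulVec_eq_smul_of_mem_spectrum hz
  obtain ⟨v, hv⟩ := exists_absoluteValue_ne_one hz1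
  have hinv : ρ γ⁻¹ * ρ γ = 1 := by rw [← map_mul, inv_mul_cancel, map_one]
  have hx' : x = z • (ρ γ⁻¹ *ᵥ x) := by
    rw [← Matrix.mulVec_smul, ← hxz, Matrix.mulVec_mulVec, hinv, Matrix.one_mulVec]
  have hz0 : z ≠ 0 := by
    rintro rfl
    exact hx (by rw [hx', zero_smul])
  -- If `v z < 1`, pass to `γ⁻¹`, which generates the same subgroup and has eigenvalue `z⁻¹` on `x`.
  rcases hv.lt_or_gt with hv | hv
  · rw [← Subgroup.zpowers_inv]
    refine isUndistorted_zpowers_of_eigenvector v hG ρ γ⁻¹ hx (z := z⁻¹) ?_ ?_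
    · rw [map_inv₀]
      exact (one_lt_inv₀ (v.pos hz0)).2 hv
    · conv_rhs => rw [hx', inv_smul_smul₀ hz0]
  · exact isUndistorted_zpowers_of_eigenvector v hG ρ γ hx hv hxz
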